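/- Let $X$ be a finite $T_0$ topological space. For $x\in X$ let $U_x$ be the intersection of all open subsets of $X$ containing $x$, and let $F_x$ be the intersection of all closed subsets of $X$ containing $x$. Put $\mathcal U=\{U_x : x\in X\}$ (the cover of $X$ by minimal open sets) and $\mathcal V=\{F_x : x\in X\}$ (the cover of $X$ by minimal closed sets). For a family $\mathcal W$ of subsets of $X$, let the nerve $\mathcal N(\mathcal W)$ be the simplicial complex whose simplices are the nonempty finite subsets $\{W_0,\dots,W_n\}$ of $\mathcal W$ with $W_0\cap\dots\cap W_n\neq\emptyset$, and let $|\cdot|$ denote geometric realization. Then $|\mathcal N(\mathcal V)|$ and $|\mathcal N(\mathcal U)|$ are homotopy equivalent. -/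

import Mathlib

/-- The `L`-complex of a relation `R` between `X` and `Y`: its simplices are the nonempty finite
sets of elements of `Y` all related to a common element of `X`. -/
def lComplex {X Y : Type*} (R : X → Y → Prop) : PreAbstractSimplicialComplex Y where
  faces := {s | s.Nonempty ∧ ∃ x, ∀ y ∈ s, R x y}
  isRelLowerSet_faces := fun _ ⟨hs, x, hx⟩ =>
    ⟨hs, fun _ hts ht => ⟨ht, x, fun y hy => hx y (hts hy)⟩⟩

/-- The nerve of a family `𝒰` of subsets of `X`: the `L`-complex of the membership relation.
Its vertices are members of `𝒰`, its simplices the nonempty finite subsets of `𝒰` with a common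
point. -/
def nerve {X : Type*} (𝒰 : Set (Set X)) : PreAbstractSimplicialComplex 𝒰 :=
  lComplex fun (x : X) (U : 𝒰) => x ∈ (U : Set X)

/-- The geometric realization of a simplicial complex with finitely many vertices, in barycentric
coordinates: the families of nonnegative weights on the vertices that vanish outside some simplex
and have sum `1`. As a subtype of the finite-dimensional space `ι → ℝ` it has the Euclidean
topology, which is the usual one for a finite complex. -/
abbrev GeomRealization {ι : Type*} [Finite ι] (K : PreAbstractSimplicialComplex ι) : Type _ :=
  {w : ι → ℝ // (∀ i, 0 ≤ w i) ∧ ∃ s ∈ K.faces, (∀ i, i ∉ s → w i = 0) ∧ ∑ i ∈ s, w i = 1}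

/-- `U_x`: the intersection of all open sets containing `x`. -/
def minOpen {X : Type*} [TopologicalSpace X] (x : X) : Set X :=
  ⋂₀ {U | IsOpen U ∧ x ∈ U}

/-- `F_x`: the intersection of all closed sets containing `x`. -/
def minClosed {X : Type*} [TopologicalSpace X] (x : X) : Set X :=
  ⋂₀ {F | IsClosed F ∧ x ∈ F}

/-- The family of all minimal open sets of `X`. -/
def minOpens (X : Type*) [TopologicalSpace X] : Set (Set X) := Set.range minOpen

/-- The family of all minimal closed sets of `X`. -/
def minCloseds (X : Type*) [TopologicalSpace X] : Set (Set X) := Set.range minClosed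

/-!
The theorem is Dowker duality for the relation "`F` meets `U`" between minimal closed sets `F` and
minimal open sets `U`. Since `F_x` consists of the specializations of `x` and `U_y` of the
generalizations of `y`, the sets `F_x` and `U_y` meet if and only if `x ∈ U_y`, if and only if
`y ∈ F_x`. Hence the two nerves are the two complexes of this relation (`lComplex_meets`,
`lComplex_flip_meets`).

For Dowker duality (`dowkerEquiv`), let `R` be a relation between finite sets `X` and `Y`, and fix
a threshold `c > 0` with `c * card Y < 1`, so that every point `v` of `|L(R)|` has a coordinate
larger than `c`. Send `v` to the point of `|L(Rᵀ)|` whose `x`-coordinate is proportional to the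
product of the `max (c - v y) 0` over all `y` not related to `x`. This product is nonzero exactly
when all `y` with `c ≤ v y` are related to `x`. So the image of `v` has a support all of whose
elements are related to all `y` with `c ≤ v y`.

Let `w` be the image of `v` under this map followed by the one for `Rᵀ`, and let `T v` be
proportional to `y ↦ max (v y - c) 0`. The supports of `v` and `T v` lie in a common simplex, and so
do those of `T v` and `w`: take any `x` whose coordinate in the image of `v` is large. Two
straight-line homotopies (`homotopic_of_common_simplex`) therefore connect the identity, through
`T`, with the composite.
-/

open scoped unitInterval

section Dowker

variable {X Y Z : Type*} [TopologicalSpace Z] {R : X → Y → Prop}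

/-! ### Points of the realization of an `L`-complex -/

theorem geomRealization_mem_iff [Fintype Y] {w : Y → ℝ} :
    ((∀ y, 0 ≤ w y) ∧ ∃ s ∈ (lComplex R).faces, (∀ y, y ∉ s → w y = 0) ∧ ∑ y ∈ s, w y = 1) ↔
      (∀ y, 0 ≤ w y) ∧ ∑ y, w y = 1 ∧ ∃ x, ∀ y, w y ≠ 0 → R x y := by
  classical
  refine and_congr_right fun _ => ⟨?_, ?_⟩
  · rintro ⟨s, ⟨_, x, hx⟩, h0, h1⟩
    refine ⟨?_, x, fun y hy => hx y (by_contra fun h => hy (h0 y h))⟩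
    rw [← h1]
    exact (Finset.sum_subset (Finset.subset_univ s) fun y _ hy => h0 y hy).symm
  · rintro ⟨h1, x, hx⟩
    have hs : ∑ y with w y ≠ 0, w y = 1 := by rw [Finset.sum_filter_ne_zero, h1]
    refine ⟨Finset.univ.filter fun y => w y ≠ 0, ⟨?_, x, fun y hy => hx y (by simpa using hy)⟩,
      fun y hy => by simpa using hy, hs⟩
    by_contra h
    rw [Finset.not_nonempty_iff_eq_empty.1 h] at hs
    simp at hs

theorem GeomRealization.sum_eq_one [Fintype Y] (v : GeomRealization (lComplex R)) :
    ∑ y, v.1 y = 1 :=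
  (geomRealization_mem_iff.1 v.2).2.1

theorem GeomRealization.exists_forall_rel [Fintype Y] (v : GeomRealization (lComplex R)) :
    ∃ x, ∀ y, v.1 y ≠ 0 → R x y :=
  (geomRealization_mem_iff.1 v.2).2.2

theorem GeomRealization.continuous_coord [Fintype Y] (y : Y) :
    Continuous fun v : GeomRealization (lComplex R) => v.1 y :=
  (continuous_apply y).comp continuous_subtype_val

/-- The continuous map into the realization obtained by dividing a family of nonnegative weights,
not all zero and supported on simplices, by its sum. -/
noncomputable def normalizedMap [Fintype Y] (a : Z → Y → ℝ) (ha : Continuous a)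
    (h0 : ∀ z y, 0 ≤ a z y) (hpos : ∀ z, ∃ y, a z y ≠ 0)
    (hR : ∀ z, ∃ x, ∀ y, a z y ≠ 0 → R x y) : C(Z, GeomRealization (lComplex R)) where
  toFun z := ⟨fun y => a z y / ∑ y', a z y', by
    have hs : ∑ y', a z y' ≠ 0 := fun h => by
      obtain ⟨y, hy⟩ := hpos z
      exact hy ((Finset.sum_eq_zero_iff_of_nonneg fun y _ => h0 z y).1 h y (Finset.mem_univ y))
    refine geomRealization_mem_iff.2
      ⟨fun y => div_nonneg (h0 z y) (Finset.sum_nonneg fun y' _ => h0 z y'), ?_, ?_⟩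
    · rw [← Finset.sum_div, div_self hs]
    · obtain ⟨x, hx⟩ := hR z
      exact ⟨x, fun y hy => hx y fun h => hy (by simp [h])⟩⟩
  continuous_toFun := by
    refine Continuous.subtype_mk (continuous_pi fun y => ?_) _
    refine Continuous.div (by fun_prop) (by fun_prop) fun z h => ?_
    obtain ⟨y, hy⟩ := hpos z
    exact hy ((Finset.sum_eq_zero_iff_of_nonneg fun y _ => h0 z y).1 h y (Finset.mem_univ y))

theorem ne_zero_of_normalizedMap_ne_zero [Fintype Y] (a : Z → Y → ℝ) {ha : Continuous a}
    {h0 : ∀ z y, 0 ≤ a z y} {hpos : ∀ z, ∃ y, a z y ≠ 0}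
    {hR : ∀ z, ∃ x, ∀ y, a z y ≠ 0 → R x y} {z : Z} {y : Y}
    (h : (normalizedMap a ha h0 hpos hR z).1 y ≠ 0) : a z y ≠ 0 :=
  fun h' => h (by simp [normalizedMap, h'])

/-- The straight-line homotopy between two maps whose values always lie in a common simplex. -/
theorem homotopic_of_common_simplex [Fintype Y] (f g : C(Z, GeomRealization (lComplex R)))
    (h : ∀ z, ∃ x, ∀ y, (f z).1 y ≠ 0 ∨ (g z).1 y ≠ 0 → R x y) : f.Homotopic g := by
  refine ⟨⟨⟨fun p => ⟨fun y => (1 - (p.1 : ℝ)) * (f p.2).1 y + (p.1 : ℝ) * (g p.2).1 y, ?_⟩, ?_⟩,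
    fun z => ?_, fun z => ?_⟩⟩
  · refine geomRealization_mem_iff.2 ⟨fun y => ?_, ?_, ?_⟩
    · exact add_nonneg (mul_nonneg (sub_nonneg.2 p.1.2.2) ((f p.2).2.1 y))
        (mul_nonneg p.1.2.1 ((g p.2).2.1 y))
    · rw [Finset.sum_add_distrib, ← Finset.mul_sum, ← Finset.mul_sum,
        GeomRealization.sum_eq_one, GeomRealization.sum_eq_one]
      ring
    · obtain ⟨x, hx⟩ := h p.2
      refine ⟨x, fun y hy => hx y ?_⟩
      by_contra! h'
      exact hy (by rw [h'.1, h'.2]; ring)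
  · refine Continuous.subtype_mk (continuous_pi fun y => ?_) _
    have hf : Continuous fun p : I × Z => (f p.2).1 y :=
      (GeomRealization.continuous_coord y).comp (f.continuous.comp continuous_snd)
    have hg : Continuous fun p : I × Z => (g p.2).1 y :=
      (GeomRealization.continuous_coord y).comp (g.continuous.comp continuous_snd)
    have ht : Continuous fun p : I × Z => (p.1 : ℝ) := continuous_subtype_val.comp continuous_fst
    exact ((continuous_const.sub ht).mul hf).add (ht.mul hg)
  · ext y
    simp
  · ext y
    simp

/-! ### Dowker duality -/

/-- A threshold that some barycentric coordinate of every point exceeds, by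
`exists_threshold_lt`. -/
noncomputable def threshold (Y : Type*) [Fintype Y] : ℝ := 1 / (Fintype.card Y + 1)

theorem threshold_pos (Y : Type*) [Fintype Y] : 0 < threshold Y := by
  unfold threshold
  positivity

theorem exists_threshold_lt [Fintype Y] (v : GeomRealization (lComplex R)) :
    ∃ y, threshold Y < v.1 y := by
  by_contra! h
  have h1 : (1 : ℝ) ≤ Fintype.card Y * threshold Y := by
    rw [← v.sum_eq_one, ← nsmul_eq_mul]
    exact Finset.sum_le_card_nsmul _ _ _ fun y _ => h y
  have h2 : (Fintype.card Y + 1 : ℝ) * threshold Y = 1 := by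
    unfold threshold
    field_simp
  linarith [threshold_pos Y]

open Classical in
/-- The unnormalized weight of `x` at `v`, nonzero exactly when `x` is related to every vertex
whose coordinate in `v` is at least the threshold. -/
noncomputable def dowkerWeight [Fintype Y] (R : X → Y → Prop) (v : Y → ℝ) (x : X) : ℝ :=
  ∏ y with ¬ R x y, max (threshold Y - v y) 0

theorem dowkerWeight_nonneg [Fintype Y] (v : Y → ℝ) (x : X) : 0 ≤ dowkerWeight R v x :=
  Finset.prod_nonneg fun _ _ => le_max_right _ _

theorem dowkerWeight_ne_zero_iff [Fintype Y] {v : Y → ℝ} {x : X} :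
    dowkerWeight R v x ≠ 0 ↔ ∀ y, threshold Y ≤ v y → R x y := by
  simp only [dowkerWeight, ne_eq, Finset.prod_eq_zero_iff, Finset.mem_filter, Finset.mem_univ,
    true_and, max_eq_right_iff, sub_nonpos, not_exists, not_and]
  exact forall_congr' fun y => by tauto

/-- The map between the realizations of the two complexes of `R` whose `x`-coordinate is
proportional to `dowkerWeight R v x`. -/
noncomputable def dowkerMap [Fintype X] [Fintype Y] (R : X → Y → Prop) :
    C(GeomRealization (lComplex R), GeomRealization (lComplex (flip R))) :=
  normalizedMap (fun v => dowkerWeight R v.1)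
    (continuous_pi fun _ => continuous_finsetProd _ fun y _ =>
      (continuous_const.sub (GeomRealization.continuous_coord y)).max continuous_const)
    (fun v => dowkerWeight_nonneg v.1)
    (fun v => v.exists_forall_rel.imp fun _ hx => dowkerWeight_ne_zero_iff.2 fun y hy =>
      hx y ((threshold_pos Y).trans_le hy).ne')
    (fun v => (exists_threshold_lt v).imp fun _ hy _ hx => dowkerWeight_ne_zero_iff.1 hx _ hy.le)

theorem rel_of_dowkerMap_ne_zero [Fintype X] [Fintype Y] {v : GeomRealization (lComplex R)}
    {x : X} (hx : (dowkerMap R v).1 x ≠ 0) {y : Y} (hy : threshold Y ≤ v.1 y) : R x y :=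
  dowkerWeight_ne_zero_iff.1
    (ne_zero_of_normalizedMap_ne_zero
      (fun v : GeomRealization (lComplex R) => dowkerWeight R v.1) hx) y hy

theorem dowkerMap_comp_homotopic_id [Fintype X] [Fintype Y] (R : X → Y → Prop) :
    ((dowkerMap (flip R)).comp (dowkerMap R)).Homotopic (ContinuousMap.id _) := by
  -- Truncating below the threshold leaves only vertices that are related to every vertex in the
  -- support of the image under `dowkerMap`.
  let T : C(GeomRealization (lComplex R), GeomRealization (lComplex R)) :=
    normalizedMap (fun v y => max (v.1 y - threshold Y) 0)
      (continuous_pi fun y =>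
        ((GeomRealization.continuous_coord y).sub continuous_const).max continuous_const)
      (fun _ _ => le_max_right _ _)
      (fun v => (exists_threshold_lt v).imp fun y hy => by
        rw [max_eq_left (sub_pos.2 hy).le]
        exact (sub_pos.2 hy).ne')
      (fun v => v.exists_forall_rel.imp fun x hx y hy => hx y fun h => hy (by
        rw [h, zero_sub]
        exact max_eq_right (neg_nonpos.2 (threshold_pos Y).le)))
  have hT (v : GeomRealization (lComplex R)) (y : Y) (hy : (T v).1 y ≠ 0) :
      threshold Y < v.1 y := by
    by_contra! h
    exact ne_zero_of_normalizedMap_ne_zero _ hy (max_eq_right (sub_nonpos.2 h))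
  refine (homotopic_of_common_simplex _ T fun v => ?_).trans
    (homotopic_of_common_simplex T _ fun v => ?_)
  · obtain ⟨x, hx⟩ := exists_threshold_lt (dowkerMap R v)
    refine ⟨x, fun y hy => hy.elim (fun h => ?_) fun h => ?_⟩
    · exact rel_of_dowkerMap_ne_zero (R := flip R) h hx.le
    · exact rel_of_dowkerMap_ne_zero ((threshold_pos X).trans hx).ne' (hT v y h).le
  · obtain ⟨x, hx⟩ := v.exists_forall_rel
    exact ⟨x, fun y hy => hx y (hy.elim (fun h => ((threshold_pos Y).trans (hT v y h)).ne') id)⟩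

/-- **Dowker duality**: the two complexes of a relation between finite sets have homotopy equivalent
realizations. -/
noncomputable def dowkerEquiv [Fintype X] [Fintype Y] (R : X → Y → Prop) :
    ContinuousMap.HomotopyEquiv (GeomRealization (lComplex R))
      (GeomRealization (lComplex (flip R))) where
  toFun := dowkerMap R
  invFun := dowkerMap (flip R)
  left_inv := dowkerMap_comp_homotopic_id R
  right_inv := dowkerMap_comp_homotopic_id (flip R)

end Dowker

/-! ### Minimal open and minimal closed sets -/

section Minimal

variable {X : Type*} [TopologicalSpace X]

theorem mem_minOpen_iff {x y : X} : x ∈ minOpen y ↔ x ⤳ y := by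
  simp only [minOpen, Set.mem_sInter, Set.mem_ofPred_eq, and_imp, specializes_iff_forall_open]

theorem mem_minClosed_iff {x y : X} : y ∈ minClosed x ↔ x ⤳ y := by
  simp only [minClosed, Set.mem_sInter, Set.mem_ofPred_eq, and_imp, specializes_iff_forall_closed]

theorem minClosed_inter_minOpen_nonempty_iff {x y : X} :
    (minClosed x ∩ minOpen y).Nonempty ↔ x ⤳ y :=
  ⟨fun ⟨_, h1, h2⟩ => (mem_minClosed_iff.1 h1).trans (mem_minOpen_iff.1 h2),
    fun h => ⟨x, mem_minClosed_iff.2 specializes_rfl, mem_minOpen_iff.2 h⟩⟩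

/-- The relation "`U` meets `F`" between minimal open sets and minimal closed sets. -/
def Meets (U : minOpens X) (F : minCloseds X) : Prop := ((F : Set X) ∩ U).Nonempty

theorem lComplex_meets : lComplex (Meets (X := X)) = nerve (minCloseds X) := by
  ext s
  refine and_congr_right fun _ => ⟨?_, ?_⟩
  · rintro ⟨⟨_, y, rfl⟩, h⟩
    refine ⟨y, ?_⟩
    rintro ⟨_, x, rfl⟩ hF
    exact mem_minClosed_iff.2 (minClosed_inter_minOpen_nonempty_iff.1 (h _ hF))
  · rintro ⟨y, h⟩
    refine ⟨⟨minOpen y, y, rfl⟩, ?_⟩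
    exact fun F hF => ⟨y, h F hF, mem_minOpen_iff.2 specializes_rfl⟩

theorem lComplex_flip_meets : lComplex (flip (Meets (X := X))) = nerve (minOpens X) := by
  ext s
  refine and_congr_right fun _ => ⟨?_, ?_⟩
  · rintro ⟨⟨_, x, rfl⟩, h⟩
    refine ⟨x, ?_⟩
    rintro ⟨_, y, rfl⟩ hU
    exact mem_minOpen_iff.2 (minClosed_inter_minOpen_nonempty_iff.1 (h _ hU))
  · rintro ⟨x, h⟩
    refine ⟨⟨minClosed x, x, rfl⟩, ?_⟩
    exact fun U hU => ⟨x, mem_minClosed_iff.2 specializes_rfl, h U hU⟩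

end Minimal

theorem mainTheorem7 (X : Type*) [TopologicalSpace X] [Finite X] [T0Space X] :
    Nonempty (ContinuousMap.HomotopyEquiv
      (GeomRealization (nerve (minCloseds X))) (GeomRealization (nerve (minOpens X)))) := by
  have := Fintype.ofFinite (minOpens X)
  have := Fintype.ofFinite (minCloseds X)
  rw [← lComplex_meets, ← lComplex_flip_meets]
  exact ⟨dowkerEquiv Meets⟩
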